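/- Let $\alpha>0$, $R>0$ and let $\mathbb{D}_R$ be the disk of radius $R$ around the origin of the hyperbolic plane (curvature $-1$), in polar coordinates $(\phi,r)$ with $r$ the hyperbolic distance to the origin. A random point of $\mathbb{D}_R$ has an angle $\phi$ uniform on $[0,2\pi)$ and, independently, a radius $r\in[0,R]$ with density $\alpha\sinh(\alpha r)/(\cosh(\alpha R)-1)$. The polar quadtree with leaf capacity $\kappa\ge 1$ holding the points $x_1,\dots,x_n$ is the following tree of cells $[\phi_0,\phi_1)\times[r_0,r_1)$. The root is $[0,2\pi)\times[0,R)$, and a cell containing more than $\kappa$ of the points is split into four children, at the angle $(\phi_0+\phi_1)/2$ and at the radius $\frac1\alpha\operatorname{arcosh}\frac{\cosh(\alpha r_0)+\cosh(\alpha r_1)}{2}$; cells that are not split are leaf cells. A bottom leaf cell is a leaf cell that has no non-leaf sibling. Map points to the Poincaré disk by $(\phi,r)\mapsto\sqrt{\frac{\cosh r-1}{\cosh r+1}}\,e^{i\phi}$. A range query is given by a Euclidean circle in the plane of the Poincaré disk. It returns the set $A$ of those points $x_i$ whose images lie strictly inside the circle. It starts by examining the root and, from an examined non-leaf cell, goes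 on to examine those children whose images meet the closed disk bounded by the circle. There are constants $K$ and $N$ such that for all $n\ge N$, all $\alpha,R>0$ and all leaf capacities $\kappa\ge1$, the following holds with probability at least $1-1/n$ for the polar quadtree holding $n$ independent random points of $\mathbb{D}_R$ distributed as above: every range query on it examines at most $K(\sqrt n+|A|)$ bottom leaf cells, where $A$ is the set of points that the query returns. -/

import Mathlib

open MeasureTheory

noncomputable section

namespace PolarQuadtree

/-- A point of the hyperbolic plane in native polar coordinates `(φ, r)`: `r` is the hyperbolic
distance to the origin. -/
abbrev PolarPoint : Type := ℝ × ℝ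

/-- The density of the radial coordinate on `[0, R]` with growth parameter `α`. -/
def radialDensity (α R r : ℝ) : ℝ :=
  α * Real.sinh (α * r) / (Real.cosh (α * R) - 1)

/-- The law of the radial coordinate. -/
def radialLaw (α R : ℝ) : Measure ℝ :=
  (volume.restrict (Set.Icc 0 R)).withDensity fun r => ENNReal.ofReal (radialDensity α R r)

/-- The law of the angular coordinate: uniform on `[0, 2π)`. -/
def angularLaw : Measure ℝ :=
  ProbabilityTheory.cond volume (Set.Ico 0 (2 * Real.pi))

/-- The law of a random vertex on the hyperbolic disk of radius `R`: the angular and the radial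
coordinate are independent. -/
def pointLaw (α R : ℝ) : Measure PolarPoint :=
  angularLaw.prod (radialLaw α R)

/-- The map from native polar coordinates to the Poincaré disk, a subset of `ℂ`. -/
def toPoincare (p : PolarPoint) : ℂ :=
  (Real.sqrt ((Real.cosh p.2 - 1) / (Real.cosh p.2 + 1)) : ℂ) * Complex.exp (p.1 * Complex.I)

/-- A cell of the quadtree, delimited by two angles and two radii (in native coordinates). -/
structure Cell where
  minPhi : ℝ
  maxPhi : ℝ
  minR : ℝ
  maxR : ℝ

namespace Cell

/-- The points, in native polar coordinates, for which the cell is responsible. -/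
def region (C : Cell) : Set PolarPoint :=
  Set.Ico C.minPhi C.maxPhi ×ˢ Set.Ico C.minR C.maxR

/-- The angle at which the cell is split. -/
def midPhi (C : Cell) : ℝ := (C.maxPhi + C.minPhi) / 2

/-- The radius at which the cell is split. -/
def midR (α : ℝ) (C : Cell) : ℝ :=
  Real.arcosh ((Real.cosh (α * C.maxR) + Real.cosh (α * C.minR)) / 2) / α

/-- The four children of a cell; the first bit of `q` selects the angular half, the second bit the
radial half. -/
def child (α : ℝ) (C : Cell) (q : Bool × Bool) : Cell where
  minPhi := if q.1 then C.midPhi else C.minPhi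
  maxPhi := if q.1 then C.maxPhi else C.midPhi
  minR := if q.2 then C.midR α else C.minR
  maxR := if q.2 then C.maxR else C.midR α

end Cell

/-- A position in the infinite 4-ary tree, as the list of the choices made on the way from the
root, the last choice first. -/
abbrev Address : Type := List (Bool × Bool)

/-- The cell at a given address of the polar quadtree on the disk of radius `R`. -/
def cellAt (α R : ℝ) : Address → Cell
  | [] => ⟨0, 2 * Real.pi, 0, R⟩
  | q :: a => (cellAt α R a).child α q

section Tree

variable (α R : ℝ) (κ : ℕ) {n : ℕ} (x : Fin n → PolarPoint)

/-- The number of the points `x 0, …, x (n - 1)` in the cell at address `a`. -/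
def load (a : Address) : ℕ :=
  Set.ncard {i : Fin n | x i ∈ (cellAt α R a).region}

/-- The nodes of the polar quadtree with leaf capacity `κ` that holds the points `x`: the root is a
node, and a node whose capacity is exceeded is split into four children. -/
inductive IsNode : Address → Prop
  | root : IsNode []
  | child (a : Address) (q : Bool × Bool) :
      IsNode a → κ < load α R x a → IsNode (q :: a)

/-- Leaf cells are the nodes that are not split. -/
def IsLeaf (a : Address) : Prop :=
  IsNode α R κ x a ∧ load α R x a ≤ κ

/-- Two different addresses with the same parent. -/
def IsSibling (a b : Address) : Prop :=
  ∃ (p : Address) (q q' : Bool × Bool), q ≠ q' ∧ a = q :: p ∧ b = q' :: p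

/-- Bottom leaf cells are the leaf cells that do not have non-leaf siblings. -/
def IsBottomLeaf (a : Address) : Prop :=
  IsLeaf α R κ x a ∧ ∀ b, IsSibling a b → IsNode α R κ x b → IsLeaf α R κ x b

/-- The points returned by the range query for the Euclidean circle with centre `c` and radius `ρ`
in the Poincaré disk. -/
def queryResult (c : ℂ) (ρ : ℝ) : Set (Fin n) :=
  {i | toPoincare (x i) ∈ Metric.ball c ρ}

/-- The nodes examined by that range query: the traversal starts at the root, and from a node that
is not a leaf it descends into those children whose cells meet the circle or its interior. -/
inductive Examined (c : ℂ) (ρ : ℝ) : Address → Prop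
  | root : Examined c ρ []
  | child (a : Address) (q : Bool × Bool) :
      Examined c ρ a → κ < load α R x a →
      (toPoincare '' (cellAt α R (q :: a)).region ∩ Metric.closedBall c ρ).Nonempty →
      Examined c ρ (q :: a)

/-- The bottom leaf cells examined by the range query. -/
def examinedBottomLeaves (c : ℂ) (ρ : ℝ) : Set Address :=
  {a | IsBottomLeaf α R κ x a ∧ Examined α R κ x c ρ a}

end Tree

end PolarQuadtree

end

/-! Cells of depth `j` are the cells of an `m × m` grid, `m = 2 ^ j`, each of probability at most `1
/ m ^ 2`, because every split halves the angle and the radial distribution function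
(`exists_mem_region_iff`). Choose `m ^ 2 ≤ n < 4 * m ^ 2`.

A Euclidean circle falls into at most nine pieces along which the angle is monotone in the radius
(`exists_monotone_pieces`). Each piece meets only grid cells of a single monotone lattice path,
which has at most `2 * m` cells, and at most `2 * 4 ^ m` paths suffice. A path has probability at
most `2 / m`, so a Chernoff bound and a union bound show that, outside an event of probability at
most `1 / n`, every path holds fewer than `20 * m` points (`measure_sparsePaths_ge`). This event
depends neither on the circle nor on the leaf capacity.

The rest is deterministic charging (`examinedParents_bound`). Parents of bottom leaf cells have
pairwise disjoint regions, and each contains a point. A parent inside the circle is charged to a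
returned point. One that meets the circle is charged to a point in a grid cell met by the circle if
it has depth at least `j`, and to such a grid cell itself if it has depth at most `j`. Each parent
has four children. -/

namespace PolarQuadtree

/-! ### Lattice paths and chains in the grid -/

/-- The cells of the `m × m` grid visited by the lattice path that starts at `(0, 0)` and
increments the first coordinate at the times in `W`, the second one at all other times. -/
def latticePath (m : ℕ) (W : Finset ℕ) : Finset (ℕ × ℕ) :=
  (Finset.range m ×ˢ Finset.range m).filter fun p => (W.filter (· < p.1 + p.2)).card = p.1

/-- The time `p.1 + p.2` determines `p.1`, and therefore the cell, and it is less than `2 * m`. -/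
theorem card_latticePath_le (m : ℕ) (W : Finset ℕ) : (latticePath m W).card ≤ 2 * m := by
  have h : ((latticePath m W).image fun p => p.1 + p.2) ⊆ Finset.range (2 * m) := by
    intro s hs
    simp only [latticePath, Finset.mem_image, Finset.mem_filter, Finset.mem_product,
      Finset.mem_range] at hs ⊢
    obtain ⟨p, hp, rfl⟩ := hs
    omega
  have hinj : Set.InjOn (fun p : ℕ × ℕ => p.1 + p.2) (latticePath m W) := by
    intro p hp q hq hpq
    simp only [latticePath, Finset.coe_filter, Set.mem_ofPred_eq] at hp hq hpq
    have h1 : p.1 = q.1 := by rw [← hp.2, ← hq.2, hpq]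
    exact Prod.ext h1 (by omega)
  calc (latticePath m W).card = _ := (Finset.card_image_of_injOn hinj).symm
    _ ≤ _ := Finset.card_le_card h
    _ = 2 * m := Finset.card_range _

-- Let `g a` be the highest row that `S` uses in columns before `a`, with value 0 if there is none.
-- The path steps from column `a` to the next at height `g (a + 1)`, that is at time `a + g (a +
-- 1)`. A cell `(a, b)` of `S` has `g a ≤ b ≤ g (a + 1)`, so exactly the steps out of the columns
-- before `a` precede time `a + b`.
open Classical in
theorem exists_latticePath (m : ℕ) (S : Set (ℕ × ℕ)) (hm : ∀ p ∈ S, p.1 < m ∧ p.2 < m)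
    (hS : ∀ p ∈ S, ∀ q ∈ S, p.1 < q.1 → p.2 ≤ q.2) :
    ∃ W ∈ (Finset.range (2 * m)).powerset, S ⊆ latticePath m W := by
  set g : ℕ → ℕ := fun a =>
    ((Finset.range m).filter fun b => ∃ a' < a, (a', b) ∈ S).sup id with hg
  have hgm : ∀ a b, b < a → g b ≤ g a := by
    intro a b hab
    apply Finset.sup_mono
    intro c hc
    simp only [Finset.mem_filter] at hc ⊢
    obtain ⟨h1, a', h2, h3⟩ := hc
    exact ⟨h1, a', h2.trans hab, h3⟩
  have hf : StrictMono fun a => a + g (a + 1) := by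
    intro a b hab
    have := hgm (b + 1) (a + 1) (by omega)
    simp only
    omega
  refine ⟨(Finset.range m).image fun a => a + g (a + 1), ?_, ?_⟩
  · rw [Finset.mem_powerset]
    intro s hs
    simp only [Finset.mem_image, Finset.mem_range] at hs ⊢
    obtain ⟨a, ha, rfl⟩ := hs
    have : g (a + 1) < m := by
      rw [hg, Finset.sup_lt_iff (by simp only [Nat.bot_eq_zero]; omega)]
      intro b hb
      simp only [Finset.mem_filter, Finset.mem_range] at hb
      exact hb.1
    omega
  · rintro ⟨a, b⟩ hp
    have hlt := hm _ hp
    simp only [latticePath, Finset.coe_filter, Set.mem_ofPred_eq, Finset.mem_product,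
      Finset.mem_range]
    refine ⟨hlt, ?_⟩
    have hlo : g a ≤ b := by
      apply Finset.sup_le
      intro c hc
      simp only [Finset.mem_filter, Finset.mem_range] at hc
      obtain ⟨h1, a', h2, h3⟩ := hc
      exact hS _ h3 _ hp h2
    have hhi : b ≤ g (a + 1) := by
      apply Finset.le_sup (f := id)
      simp only [Finset.mem_filter, Finset.mem_range]
      exact ⟨hlt.2, a, by omega, hp⟩
    have hW : ((Finset.range m).image fun a => a + g (a + 1)).filter (· < a + b) =
        (Finset.range a).image fun a => a + g (a + 1) := by
      ext s
      simp only [Finset.mem_filter, Finset.mem_image, Finset.mem_range]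
      constructor
      · rintro ⟨⟨a', h1, rfl⟩, h2⟩
        refine ⟨a', ?_, rfl⟩
        by_contra h3
        rcases (not_lt.1 h3).eq_or_lt with h4 | h4
        · subst h4; omega
        · have := hf h4
          simp only at this
          omega
      · rintro ⟨a', h1, rfl⟩
        refine ⟨⟨a', by omega, rfl⟩, ?_⟩
        rcases (Nat.succ_le_of_lt h1).eq_or_lt with h2 | h2
        · have h3 : a' + 1 = a := h2
          rw [h3]
          omega
        · have := hgm a (a' + 1) h2
          omega
    rw [hW, Finset.card_image_of_injective _ hf.injective, Finset.card_range]

/-- A family of subsets of the `m × m` grid that is cofinal among the chains of the product order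
and among the chains of the order with the first coordinate reversed. -/
def pathFamily (m : ℕ) : Finset (Finset (ℕ × ℕ)) :=
  (Finset.range (2 * m)).powerset.image (latticePath m) ∪
    (Finset.range (2 * m)).powerset.image fun W =>
      (latticePath m W).image fun p => (m - 1 - p.1, p.2)

theorem card_pathFamily_le (m : ℕ) : (pathFamily m).card ≤ 2 * 4 ^ m := by
  have h : (Finset.range (2 * m)).powerset.card = 4 ^ m := by
    rw [Finset.card_powerset, Finset.card_range, pow_mul]
    norm_num
  have h1 := Finset.card_image_le (s := (Finset.range (2 * m)).powerset) (f := latticePath m)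
  have h2 := Finset.card_image_le (s := (Finset.range (2 * m)).powerset)
    (f := fun W => (latticePath m W).image fun p => (m - 1 - p.1, p.2))
  have h3 := Finset.card_union_le ((Finset.range (2 * m)).powerset.image (latticePath m))
    ((Finset.range (2 * m)).powerset.image fun W =>
      (latticePath m W).image fun p => (m - 1 - p.1, p.2))
  unfold pathFamily
  omega

theorem card_le_of_mem_pathFamily {m : ℕ} {T : Finset (ℕ × ℕ)} (hT : T ∈ pathFamily m) :
    T.card ≤ 2 * m := by
  rcases Finset.mem_union.1 hT with h | h <;> obtain ⟨W, -, rfl⟩ := Finset.mem_image.1 h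
  · exact card_latticePath_le m W
  · exact Finset.card_image_le.trans (card_latticePath_le m W)

theorem exists_mem_pathFamily (m : ℕ) (S : Set (ℕ × ℕ)) (hm : ∀ p ∈ S, p.1 < m ∧ p.2 < m)
    (hS : (∀ p ∈ S, ∀ q ∈ S, p.1 < q.1 → p.2 ≤ q.2) ∨
      (∀ p ∈ S, ∀ q ∈ S, p.1 < q.1 → q.2 ≤ p.2)) :
    ∃ T ∈ pathFamily m, S ⊆ T := by
  rcases hS with hS | hS
  · obtain ⟨W, hW, h⟩ := exists_latticePath m S hm hS
    exact ⟨_, Finset.mem_union_left _ (Finset.mem_image_of_mem _ hW), h⟩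
  -- Reflecting the first coordinate turns a decreasing chain into an increasing one; the reflection
  -- is an involution of the grid.
  · obtain ⟨W, hW, h⟩ := exists_latticePath m ((fun p => (m - 1 - p.1, p.2)) '' S) (by
      rintro _ ⟨p, hp, rfl⟩
      have := hm p hp
      exact ⟨by simp only; omega, this.2⟩) (by
      rintro _ ⟨p, hp, rfl⟩ _ ⟨q, hq, rfl⟩ hpq
      exact hS q hq p hp (by simp only at hpq; omega))
    refine ⟨_, Finset.mem_union_right _ (Finset.mem_image_of_mem _ hW), fun p hp => ?_⟩
    have hp1 := hm p hp
    have hp2 := h ⟨p, hp, rfl⟩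
    rw [Finset.mem_coe, Finset.mem_image]
    exact ⟨_, hp2, Prod.ext (by simp only; omega) rfl⟩

/-! ### Circles in polar coordinates -/

/-- The distance to the origin of the Poincaré disk, as a function of the hyperbolic one. -/
noncomputable def poincareRadius (r : ℝ) : ℝ :=
  Real.sqrt ((Real.cosh r - 1) / (Real.cosh r + 1))

theorem strictMonoOn_poincareRadius : StrictMonoOn poincareRadius (Set.Ici 0) := by
  intro r hr r' hr' h
  have h1 : Real.cosh r < Real.cosh r' := Real.cosh_strictMonoOn hr hr' h
  have h2 := Real.one_le_cosh r
  apply Real.sqrt_lt_sqrt (div_nonneg (by linarith) (by linarith))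
  rw [div_lt_div_iff₀ (by linarith) (by linarith)]
  nlinarith

theorem poincareRadius_zero : poincareRadius 0 = 0 := by simp [poincareRadius]

theorem continuous_toPoincare : Continuous toPoincare := by
  unfold toPoincare
  have h : Continuous fun p : PolarPoint =>
      Real.sqrt ((Real.cosh p.2 - 1) / (Real.cosh p.2 + 1)) := by
    apply Real.continuous_sqrt.comp
    apply Continuous.div
    · exact (Real.continuous_cosh.comp continuous_snd).sub continuous_const
    · exact (Real.continuous_cosh.comp continuous_snd).add continuous_const
    · intro p
      have := Real.one_le_cosh p.2
      linarith
  exact (Complex.continuous_ofReal.comp h).mul (by fun_prop)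

/-- Any two points of the set are comparable in the product order. -/
def IsMonotoneSet (Q : Set PolarPoint) : Prop :=
  ∀ y ∈ Q, ∀ z ∈ Q, y.2 ≤ z.2 → y.1 ≤ z.1 ∨ y.2 = z.2

/-- Any two points of the set are comparable if the order of the angles is reversed. -/
def IsAntitoneSet (Q : Set PolarPoint) : Prop :=
  ∀ y ∈ Q, ∀ z ∈ Q, y.2 ≤ z.2 → z.1 ≤ y.1 ∨ y.2 = z.2

/-- The points of a disk that are mapped to a given circle. -/
def circlePoints (R : ℝ) (c : ℂ) (ρ : ℝ) : Set PolarPoint :=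
  {y | y ∈ Set.Ico 0 (2 * Real.pi) ×ˢ Set.Ico 0 R ∧ ‖toPoincare y - c‖ = ρ}

/-- The law of cosines for the triangle formed by the origin, `c` and the image of `y`. -/
theorem norm_sq_toPoincare_sub (y : PolarPoint) (c : ℂ) :
    ‖toPoincare y - c‖ ^ 2 = poincareRadius y.2 ^ 2 -
      2 * poincareRadius y.2 * ‖c‖ * Real.cos (y.1 - c.arg) + ‖c‖ ^ 2 := by
  have hre : (toPoincare y).re = poincareRadius y.2 * Real.cos y.1 := by
    simp [toPoincare, poincareRadius, Complex.exp_ofReal_mul_I_re]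
  have him : (toPoincare y).im = poincareRadius y.2 * Real.sin y.1 := by
    simp [toPoincare, poincareRadius, Complex.exp_ofReal_mul_I_im]
  have h1 := Complex.norm_mul_cos_arg c
  have h2 := Complex.norm_mul_sin_arg c
  rw [Complex.sq_norm, Complex.normSq_apply, Complex.sub_re, Complex.sub_im, hre, him, ← h1, ← h2,
    Real.cos_sub]
  have h3 := Real.sin_sq_add_cos_sq y.1
  have h4 := Real.sin_sq_add_cos_sq c.arg
  linear_combination (poincareRadius y.2) ^ 2 * h3 + ‖c‖ ^ 2 * h4

/-- On each half-period, the cosine is strictly monotone. -/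
theorem cos_half_period (k : ℕ) :
    (StrictMonoOn Real.cos (Set.Icc ((k : ℝ) * Real.pi - Real.pi) (k * Real.pi))) ∨
    (StrictAntiOn Real.cos (Set.Icc ((k : ℝ) * Real.pi - Real.pi) (k * Real.pi))) := by
  induction k with
  | zero =>
    left
    intro a ha b hb hab
    simp only [Nat.cast_zero, zero_mul, zero_sub, Set.mem_Icc] at ha hb
    rw [← Real.cos_neg a, ← Real.cos_neg b]
    exact Real.strictAntiOn_cos ⟨by linarith, by linarith⟩ ⟨by linarith, by linarith⟩
      (by linarith)
  | succ k ih =>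
    rcases ih with h | h
    · right
      intro a ha b hb hab
      simp only [Nat.cast_succ, Set.mem_Icc] at ha hb
      have := @h (a - Real.pi) ⟨by linarith, by linarith⟩ (b - Real.pi)
        ⟨by linarith, by linarith⟩ (by linarith)
      rw [Real.cos_sub_pi, Real.cos_sub_pi] at this
      linarith
    · left
      intro a ha b hb hab
      simp only [Nat.cast_succ, Set.mem_Icc] at ha hb
      have := @h (a - Real.pi) ⟨by linarith, by linarith⟩ (b - Real.pi)
        ⟨by linarith, by linarith⟩ (by linarith)
      rw [Real.cos_sub_pi, Real.cos_sub_pi] at this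
      linarith

/-- Where the cosine is strictly monotone, comparing angles amounts to comparing cosines, and the
equation of a circle gives the cosine as a function of the radius. -/
theorem monotone_or_antitone_of_cos {Q : Set PolarPoint} {θ : ℝ} {I : Set ℝ}
    (hQ : ∀ y ∈ Q, y.1 - θ ∈ I)
    (hcos : StrictMonoOn Real.cos I ∨ StrictAntiOn Real.cos I)
    (h : (∀ y ∈ Q, ∀ z ∈ Q, y.2 ≤ z.2 → Real.cos (y.1 - θ) ≤ Real.cos (z.1 - θ)) ∨
      (∀ y ∈ Q, ∀ z ∈ Q, y.2 ≤ z.2 → Real.cos (z.1 - θ) ≤ Real.cos (y.1 - θ))) :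
    IsMonotoneSet Q ∨ IsAntitoneSet Q := by
  rcases hcos with hc | hc <;> rcases h with h | h
  · left
    intro y hy z hz hyz
    have := (hc.le_iff_le (hQ y hy) (hQ z hz)).1 (h y hy z hz hyz)
    left; linarith
  · right
    intro y hy z hz hyz
    have := (hc.le_iff_le (hQ z hz) (hQ y hy)).1 (h y hy z hz hyz)
    left; linarith
  · right
    intro y hy z hz hyz
    have := (hc.le_iff_ge (hQ y hy) (hQ z hz)).1 (h y hy z hz hyz)
    left; linarith
  · left
    intro y hy z hz hyz
    have := (hc.le_iff_ge (hQ z hz) (hQ y hy)).1 (h y hy z hz hyz)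
    left; linarith

/-- A Euclidean circle in the Poincaré disk consists of at most nine pieces that are monotone or
antitone in polar coordinates. -/
theorem exists_monotone_pieces (R : ℝ) (c : ℂ) (ρ : ℝ) :
    ∃ Q : Option (Fin 4 × Bool) → Set PolarPoint,
      (∀ k, IsMonotoneSet (Q k) ∨ IsAntitoneSet (Q k)) ∧
      circlePoints R c ρ = ⋃ k, Q k := by
  -- `k` is the power of the origin with respect to the circle. On the circle the cosine is `(s + k
  -- / s) / (2 * ‖c‖)`, which decreases in `s` while `s ^ 2 ≤ k` and increases afterwards.
  set k : ℝ := ‖c‖ ^ 2 - ρ ^ 2 with hk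
  set s : PolarPoint → ℝ := fun y => poincareRadius y.2 with hs
  have hpos : ∀ y ∈ circlePoints R c ρ, y.2 ≠ 0 → 0 < s y := by
    intro y hy hy0
    rw [← poincareRadius_zero]
    exact strictMonoOn_poincareRadius (Set.mem_Ici.2 le_rfl) hy.1.2.1
      (lt_of_le_of_ne hy.1.2.1 (Ne.symm hy0))
  have heq : ∀ y ∈ circlePoints R c ρ,
      s y ^ 2 + k = 2 * s y * ‖c‖ * Real.cos (y.1 - c.arg) := by
    intro y hy
    have := norm_sq_toPoincare_sub y c
    rw [hy.2] at this
    simp only [hs, hk]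
    linarith
  have hmono : ∀ y ∈ circlePoints R c ρ, ∀ z ∈ circlePoints R c ρ, y.2 ≤ z.2 → s y ≤ s z :=
    fun y hy z hz h => strictMonoOn_poincareRadius.monotoneOn hy.1.2.1 hz.1.2.1 h
  -- One piece is the origin, where division by `s` fails. The others combine the two sides of `s ^
  -- 2 = k` with four half-periods, which cover `[-π, 3π]` and so every value of `y.1 - c.arg`.
  refine ⟨fun o => o.elim {y | y ∈ circlePoints R c ρ ∧ y.2 = 0} fun i =>
    {y | y ∈ circlePoints R c ρ ∧ y.2 ≠ 0 ∧
      y.1 - c.arg ∈ Set.Icc (((i.1 : ℕ) : ℝ) * Real.pi - Real.pi) ((i.1 : ℕ) * Real.pi) ∧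
      if i.2 then k ≤ s y ^ 2 else s y ^ 2 ≤ k}, ?_, ?_⟩
  · rintro (_ | ⟨i, b⟩)
    · left
      intro y hy z hz _
      right
      rw [hy.2, hz.2]
    · simp only [Option.elim]
      -- A circle around the origin has a single radius, so the alternative of equal radii applies.
      rcases eq_or_ne c 0 with h0 | h0
      · left
        intro y hy z hz _
        right
        have h1 := heq y hy.1
        have h2 := heq z hz.1
        rw [h0] at h1 h2
        simp only [norm_zero, mul_zero, zero_mul] at h1 h2
        have h3 : s y = s z := by
          refine (sq_eq_sq₀ (Real.sqrt_nonneg _) (Real.sqrt_nonneg _)).1 (?_ : s y ^ 2 = s z ^ 2)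
          linarith
        exact strictMonoOn_poincareRadius.injOn hy.1.1.2.1 hz.1.1.2.1 h3
      · have hd : 0 < ‖c‖ := norm_pos_iff.2 h0
        apply monotone_or_antitone_of_cos (θ := c.arg) (fun y hy => hy.2.2.1)
          (cos_half_period i)
        -- Eliminating the squares between the two circle equations: for `s y ≤ s z`, the cosines
        -- compare according to the sign of `s y * s z - k`, which is constant on each side of `s ^
        -- 2 = k`.
        have key : ∀ y z : PolarPoint, y ∈ circlePoints R c ρ → z ∈ circlePoints R c ρ →
            y.2 ≠ 0 → z.2 ≠ 0 →
            (2 * ‖c‖ * s y * s z) * (Real.cos (z.1 - c.arg) - Real.cos (y.1 - c.arg)) =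
              (s z - s y) * (s y * s z - k) := by
          intro y z hy hz _ _
          have h1 := heq y hy
          have h2 := heq z hz
          linear_combination s z * h1 - s y * h2
        cases b
        · right
          intro y hy z hz hyz
          have h1 := hpos y hy.1 hy.2.1
          have h2 := hpos z hz.1 hz.2.1
          have h3 := hmono y hy.1 z hz.1 hyz
          have h4 := key y z hy.1 hz.1 hy.2.1 hz.2.1
          have h5 : s z ^ 2 ≤ k := by simpa using hz.2.2.2
          have h6 : (s z - s y) * (s y * s z - k) ≤ 0 :=
            mul_nonpos_of_nonneg_of_nonpos (by linarith) (by nlinarith)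
          rw [← h4] at h6
          have := nonpos_of_mul_nonpos_right h6 (by positivity)
          linarith
        · left
          intro y hy z hz hyz
          have h1 := hpos y hy.1 hy.2.1
          have h2 := hpos z hz.1 hz.2.1
          have h3 := hmono y hy.1 z hz.1 hyz
          have h4 := key y z hy.1 hz.1 hy.2.1 hz.2.1
          have h5 : k ≤ s y ^ 2 := by simpa using hy.2.2.2
          have h6 : 0 ≤ (s z - s y) * (s y * s z - k) :=
            mul_nonneg (by linarith) (by nlinarith)
          rw [← h4] at h6
          have := nonneg_of_mul_nonneg_right h6 (by positivity)
          linarith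
  · ext y
    simp only [Set.mem_iUnion]
    constructor
    · intro hy
      by_cases h0 : y.2 = 0
      · exact ⟨none, hy, h0⟩
      · obtain ⟨j, hj⟩ : ∃ j : Fin 4, y.1 - c.arg ∈
            Set.Icc (((j : ℕ) : ℝ) * Real.pi - Real.pi) ((j : ℕ) * Real.pi) := by
          have h1 := hy.1.1.1
          have h2 := hy.1.1.2
          have h3 := Complex.neg_pi_lt_arg c
          have h4 := Complex.arg_le_pi c
          simp only [Set.mem_Icc]
          by_cases e0 : y.1 - c.arg ≤ 0
          · exact ⟨0, by norm_num; constructor <;> linarith⟩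
          by_cases e1 : y.1 - c.arg ≤ Real.pi
          · exact ⟨1, by norm_num; constructor <;> linarith⟩
          by_cases e2 : y.1 - c.arg ≤ 2 * Real.pi
          · exact ⟨2, by norm_num; constructor <;> linarith⟩
          · exact ⟨3, by norm_num; constructor <;> linarith⟩
        rcases le_total k (s y ^ 2) with hb | hb
        · exact ⟨some (j, true), hy, h0, hj, by simpa using hb⟩
        · exact ⟨some (j, false), hy, h0, hj, by simpa using hb⟩
    · rintro ⟨_ | i, hy⟩ <;> exact hy.1

/-! ### Quadtree cells as dyadic grid cells -/

/-- The cumulative distribution function of the radial coordinate. -/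
noncomputable def radialCdf (α R r : ℝ) : ℝ :=
  (Real.cosh (α * r) - 1) / (Real.cosh (α * R) - 1)

/-- The cell of the `m × m` grid of cells of equal probability that contains a given point. -/
noncomputable def gridIndex (α R : ℝ) (m : ℕ) (y : PolarPoint) : ℕ × ℕ :=
  (⌊(m : ℝ) * (y.1 / (2 * Real.pi))⌋₊, ⌊(m : ℝ) * radialCdf α R y.2⌋₊)

section

variable {α R : ℝ}

theorem cosh_mul_sub_one_pos (hα : 0 < α) (hR : 0 < R) : 0 < Real.cosh (α * R) - 1 :=
  sub_pos.2 (Real.one_lt_cosh.2 (mul_pos hα hR).ne')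

theorem radialCdf_strictMonoOn (hα : 0 < α) (hR : 0 < R) :
    StrictMonoOn (radialCdf α R) (Set.Ici 0) := by
  intro r hr r' hr' h
  have h1 : Real.cosh (α * r) < Real.cosh (α * r') :=
    Real.cosh_strictMonoOn (mul_nonneg hα.le hr) (mul_nonneg hα.le hr')
      (mul_lt_mul_of_pos_left h hα)
  exact div_lt_div_of_pos_right (by linarith) (cosh_mul_sub_one_pos hα hR)

theorem radialCdf_zero : radialCdf α R 0 = 0 := by simp [radialCdf]

theorem radialCdf_self (hα : 0 < α) (hR : 0 < R) : radialCdf α R R = 1 :=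
  div_self (cosh_mul_sub_one_pos hα hR).ne'

theorem radialCdf_nonneg (hα : 0 < α) (hR : 0 < R) (r : ℝ) : 0 ≤ radialCdf α R r :=
  div_nonneg (sub_nonneg.2 (Real.one_le_cosh _)) (cosh_mul_sub_one_pos hα hR).le

/-- The splitting radius is the conditional median of the radius in the cell, which makes the tree
dyadic in the coordinates of `gridIndex`. -/
theorem radialCdf_midR (hα : 0 < α) (C : Cell) :
    radialCdf α R (C.midR α) = (radialCdf α R C.minR + radialCdf α R C.maxR) / 2 := by
  have h1 := Real.one_le_cosh (α * C.minR)
  have h2 := Real.one_le_cosh (α * C.maxR)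
  unfold radialCdf Cell.midR
  rw [mul_div_cancel₀ _ hα.ne', Real.cosh_arcosh (by linarith)]
  ring

theorem midR_nonneg (hα : 0 < α) (C : Cell) : 0 ≤ C.midR α := by
  have h1 := Real.one_le_cosh (α * C.minR)
  have h2 := Real.one_le_cosh (α * C.maxR)
  exact div_nonneg (Real.arcosh_nonneg (by linarith)) hα.le

theorem exists_cell_bounds (hα : 0 < α) (hR : 0 < R) (a : Address) :
    ∃ A B : ℕ,
      (cellAt α R a).minPhi = 2 * Real.pi * (A / 2 ^ a.length) ∧
      (cellAt α R a).maxPhi = 2 * Real.pi * ((A + 1) / 2 ^ a.length) ∧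
      0 ≤ (cellAt α R a).minR ∧ (cellAt α R a).minR < (cellAt α R a).maxR ∧
      (cellAt α R a).maxR ≤ R ∧ A < 2 ^ a.length ∧
      radialCdf α R (cellAt α R a).minR = B / 2 ^ a.length ∧
      radialCdf α R (cellAt α R a).maxR = (B + 1) / 2 ^ a.length := by
  induction a with
  | nil =>
    refine ⟨0, 0, ?_⟩
    simp [cellAt, radialCdf_zero, radialCdf_self hα hR, hR]
  | cons q a ih =>
    obtain ⟨A, B, h1, h2, h3, h4, h5, h6, h7, h8⟩ := ih
    set C := cellAt α R a with hC
    have hmid := radialCdf_midR (R := R) hα C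
    have hmid0 := midR_nonneg hα C
    have hlt := radialCdf_strictMonoOn hα hR h3 (h3.trans h4.le) h4
    have hlo : C.minR < C.midR α :=
      ((radialCdf_strictMonoOn hα hR).lt_iff_lt h3 hmid0).1 (by rw [hmid]; linarith)
    have hhi : C.midR α < C.maxR :=
      ((radialCdf_strictMonoOn hα hR).lt_iff_lt hmid0 (h3.trans h4.le)).1 (by rw [hmid]; linarith)
    have hpow : (2 : ℝ) ^ a.length ≠ 0 := by positivity
    -- Each choice appends one binary digit to either index.
    refine ⟨2 * A + q.1.toNat, 2 * B + q.2.toNat, ?_⟩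
    obtain ⟨q1, q2⟩ := q
    simp only [cellAt, Cell.child, ← hC, List.length_cons, pow_succ]
    refine ⟨?_, ?_, ?_, ?_, ?_, ?_, ?_, ?_⟩
    · cases q1 <;> simp [Cell.midPhi, h1, h2] <;> field_simp <;> ring
    · cases q1 <;> simp [Cell.midPhi, h1, h2] <;> field_simp <;> ring
    · cases q2 <;> simp [h3, hmid0]
    · cases q2 <;> simp [hlo, hhi]
    · cases q2 <;> simp [h5, hhi.le.trans h5]
    · have := Bool.toNat_le q1
      omega
    · cases q2
      · simp only [Bool.false_eq_true, if_false, h7, Bool.toNat_false]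
        push_cast; field_simp; ring
      · simp only [if_true, hmid, h7, h8, Bool.toNat_true]
        push_cast; field_simp; ring
    · cases q2
      · simp only [Bool.false_eq_true, if_false, hmid, h7, h8, Bool.toNat_false]
        push_cast; field_simp; ring
      · simp only [if_true, h8, Bool.toNat_true]
        push_cast; field_simp; ring

theorem floor_pow_mul_eq_iff {k A : ℕ} {v : ℝ} (hv : 0 ≤ v) :
    ⌊((2 ^ k : ℕ) : ℝ) * v⌋₊ = A ↔ (A : ℝ) / 2 ^ k ≤ v ∧ v < (A + 1) / 2 ^ k := by
  have hpow : (0 : ℝ) < 2 ^ k := by positivity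
  rw [Nat.floor_eq_iff (by positivity), div_le_iff₀ hpow, lt_div_iff₀ hpow, mul_comm]
  push_cast
  rfl

/-- The domain of the quadtree: the region of its root cell. -/
def rootRegion (R : ℝ) : Set PolarPoint := Set.Ico 0 (2 * Real.pi) ×ˢ Set.Ico 0 R

theorem exists_mem_region_iff (hα : 0 < α) (hR : 0 < R) (a : Address) :
    ∃ p : ℕ × ℕ, ∀ y : PolarPoint, y ∈ (cellAt α R a).region ↔
      y ∈ rootRegion R ∧ gridIndex α R (2 ^ a.length) y = p := by
  obtain ⟨A, B, h1, h2, h3, h4, h5, h6, h7, h8⟩ := exists_cell_bounds hα hR a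
  refine ⟨(A, B), fun y => ?_⟩
  have hpi : 0 < 2 * Real.pi := by positivity
  have hpow : (0 : ℝ) < 2 ^ a.length := by positivity
  have h6' : ((A : ℝ) + 1) / 2 ^ a.length ≤ 1 := by
    rw [div_le_one hpow]
    exact_mod_cast h6
  have hphi : y.1 ∈ Set.Ico (cellAt α R a).minPhi (cellAt α R a).maxPhi ↔
      y.1 ∈ Set.Ico 0 (2 * Real.pi) ∧
        ⌊((2 ^ a.length : ℕ) : ℝ) * (y.1 / (2 * Real.pi))⌋₊ = A := by
    rw [h1, h2, Set.mem_Ico, Set.mem_Ico]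
    constructor
    · rintro ⟨h, h'⟩
      have h0 : 0 ≤ y.1 := le_trans (by positivity) h
      refine ⟨⟨h0, h'.trans_le ?_⟩, ?_⟩
      · nlinarith
      · rw [floor_pow_mul_eq_iff (div_nonneg h0 hpi.le), le_div_iff₀' hpi, div_lt_iff₀' hpi]
        exact ⟨h, h'⟩
    · rintro ⟨⟨h0, _⟩, h⟩
      rwa [floor_pow_mul_eq_iff (div_nonneg h0 hpi.le), le_div_iff₀' hpi, div_lt_iff₀' hpi] at h
  have hr : y.2 ∈ Set.Ico (cellAt α R a).minR (cellAt α R a).maxR ↔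
      y.2 ∈ Set.Ico 0 R ∧ ⌊((2 ^ a.length : ℕ) : ℝ) * radialCdf α R y.2⌋₊ = B := by
    rw [floor_pow_mul_eq_iff (radialCdf_nonneg hα hR _), ← h7, ← h8]
    have hmono := radialCdf_strictMonoOn hα hR
    constructor
    · rintro ⟨h, h'⟩
      have h0 : 0 ≤ y.2 := h3.trans h
      exact ⟨⟨h0, h'.trans_le h5⟩, (hmono.le_iff_le h3 h0).2 h,
        (hmono.lt_iff_lt h0 (h3.trans h4.le)).2 h'⟩
    · rintro ⟨⟨h0, _⟩, h, h'⟩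
      exact ⟨(hmono.le_iff_le h3 h0).1 h, (hmono.lt_iff_lt h0 (h3.trans h4.le)).1 h'⟩
  rw [Cell.region, Set.mem_prod, hphi, hr, rootRegion, Set.mem_prod, gridIndex, Prod.ext_iff]
  tauto

theorem region_child_subset (hα : 0 < α) (hR : 0 < R) (q : Bool × Bool) (a : Address) :
    (cellAt α R (q :: a)).region ⊆ (cellAt α R a).region := by
  obtain ⟨A, B, h1, h2, h3, h4, h5, h6, h7, h8⟩ := exists_cell_bounds hα hR a
  set C := cellAt α R a with hC
  have hmid := radialCdf_midR (R := R) hα C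
  have hmid0 := midR_nonneg hα C
  have hlt := radialCdf_strictMonoOn hα hR h3 (h3.trans h4.le) h4
  have hlo : C.minR < C.midR α :=
    ((radialCdf_strictMonoOn hα hR).lt_iff_lt h3 hmid0).1 (by rw [hmid]; linarith)
  have hhi : C.midR α < C.maxR :=
    ((radialCdf_strictMonoOn hα hR).lt_iff_lt hmid0 (h3.trans h4.le)).1 (by rw [hmid]; linarith)
  have hphi : C.minPhi ≤ C.maxPhi := by
    rw [h1, h2]
    gcongr
    linarith
  obtain ⟨q1, q2⟩ := q
  simp only [cellAt, ← hC]
  apply Set.prod_mono <;> apply Set.Ico_subset_Ico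
  · cases q1 <;> simp [Cell.child, Cell.midPhi]; linarith
  · cases q1 <;> simp [Cell.child, Cell.midPhi]; linarith
  · cases q2 <;> simp [Cell.child, hlo.le]
  · cases q2 <;> simp [Cell.child, hhi.le]

theorem region_append_subset (hα : 0 < α) (hR : 0 < R) (l a : Address) :
    (cellAt α R (l ++ a)).region ⊆ (cellAt α R a).region := by
  induction l with
  | nil => exact subset_rfl
  | cons q l ih => exact (region_child_subset hα hR q (l ++ a)).trans ih

theorem eq_of_mem_child {C : Cell} {q q' : Bool × Bool} {y : PolarPoint}
    (h : y ∈ (C.child α q).region) (h' : y ∈ (C.child α q').region) : q = q' := by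
  obtain ⟨q1, q2⟩ := q
  obtain ⟨q1', q2'⟩ := q'
  obtain ⟨⟨h1, h2⟩, h3, h4⟩ := h
  obtain ⟨⟨h1', h2'⟩, h3', h4'⟩ := h'
  have e1 : q1 = q1' := by
    cases q1 <;> cases q1' <;> simp [Cell.child] at h1 h2 h1' h2' ⊢ <;> linarith
  have e2 : q2 = q2' := by
    cases q2 <;> cases q2' <;> simp [Cell.child] at h3 h4 h3' h4' ⊢ <;> linarith
  rw [e1, e2]

theorem eq_of_mem_region (hα : 0 < α) (hR : 0 < R) {y : PolarPoint} :
    ∀ {a b : Address}, a.length = b.length → y ∈ (cellAt α R a).region →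
      y ∈ (cellAt α R b).region → a = b
  | [], [], _, _, _ => rfl
  | [], _ :: _, h, _, _ => by simp at h
  | _ :: _, [], h, _, _ => by simp at h
  | q :: a, q' :: b, h, ha, hb => by
    have hab : a = b := eq_of_mem_region hα hR (by simpa using h)
      (region_child_subset hα hR q a ha) (region_child_subset hα hR q' b hb)
    subst hab
    rw [eq_of_mem_child ha hb]

/-- Addresses list the last choice first, so ancestors are suffixes. Cells of equal depth are
disjoint, hence the ancestor of `b` at the depth of `a` is `a`. -/
theorem suffix_of_mem_region (hα : 0 < α) (hR : 0 < R) {y : PolarPoint} {a b : Address}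
    (hle : a.length ≤ b.length) (ha : y ∈ (cellAt α R a).region)
    (hb : y ∈ (cellAt α R b).region) : ∃ l, b = l ++ a := by
  refine ⟨b.take (b.length - a.length), ?_⟩
  have hb' : b = b.take (b.length - a.length) ++ b.drop (b.length - a.length) :=
    (List.take_append_drop _ _).symm
  have hmem : y ∈ (cellAt α R (b.drop (b.length - a.length))).region := by
    rw [hb'] at hb
    exact region_append_subset hα hR _ _ hb
  exact hb'.trans (by rw [← eq_of_mem_region hα hR (by simp; omega) ha hmem])

theorem region_subset_rootRegion (hα : 0 < α) (hR : 0 < R) (a : Address) :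
    (cellAt α R a).region ⊆ rootRegion R := by
  have := region_append_subset hα hR a []
  rwa [List.append_nil] at this

/-- The ancestor of `a` at depth `j` is a single grid cell and contains the cell at `a`. -/
theorem gridIndex_eq_of_mem_region (hα : 0 < α) (hR : 0 < R) {j : ℕ} {a : Address}
    (hj : j ≤ a.length) {y z : PolarPoint} (hy : y ∈ (cellAt α R a).region)
    (hz : z ∈ (cellAt α R a).region) : gridIndex α R (2 ^ j) y = gridIndex α R (2 ^ j) z := by
  obtain ⟨p, hp⟩ := exists_mem_region_iff hα hR (a.drop (a.length - j))
  have ha : a = a.take (a.length - j) ++ a.drop (a.length - j) :=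
    (List.take_append_drop _ _).symm
  have hlen : (a.drop (a.length - j)).length = j := by simp; omega
  rw [ha] at hy hz
  have h1 := ((hp y).1 (region_append_subset hα hR _ _ hy)).2
  have h2 := ((hp z).1 (region_append_subset hα hR _ _ hz)).2
  rw [hlen] at h1 h2
  rw [h1, h2]

theorem gridIndex_coarsen {k j : ℕ} (hk : k ≤ j) (y : PolarPoint) :
    gridIndex α R (2 ^ k) y =
      ((gridIndex α R (2 ^ j) y).1 / 2 ^ (j - k), (gridIndex α R (2 ^ j) y).2 / 2 ^ (j - k)) := by
  have h : ∀ v : ℝ, ((2 ^ k : ℕ) : ℝ) * v = ((2 ^ j : ℕ) : ℝ) * v / ((2 ^ (j - k) : ℕ) : ℝ) := by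
    intro v
    obtain ⟨i, rfl⟩ := Nat.exists_eq_add_of_le hk
    rw [Nat.add_sub_cancel_left]
    push_cast
    field_simp
    ring
  simp only [gridIndex]
  rw [h, h (radialCdf α R y.2), Nat.floor_div_natCast, Nat.floor_div_natCast]

/-- The converse regime: a cell of depth at most `j` is a union of grid cells, since a fine index
determines the coarser ones. -/
theorem mem_region_of_gridIndex_eq (hα : 0 < α) (hR : 0 < R) {j : ℕ} {a : Address}
    (hj : a.length ≤ j) {y z : PolarPoint} (hy : y ∈ (cellAt α R a).region)
    (hz : z ∈ rootRegion R) (h : gridIndex α R (2 ^ j) y = gridIndex α R (2 ^ j) z) :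
    z ∈ (cellAt α R a).region := by
  obtain ⟨p, hp⟩ := exists_mem_region_iff hα hR a
  rw [hp]
  refine ⟨hz, ?_⟩
  rw [← ((hp y).1 hy).2, gridIndex_coarsen hj, gridIndex_coarsen hj, h]

theorem gridIndex_lt (hα : 0 < α) (hR : 0 < R) {m : ℕ} (hm : 0 < m) {y : PolarPoint}
    (hy : y ∈ rootRegion R) : (gridIndex α R m y).1 < m ∧ (gridIndex α R m y).2 < m := by
  have hm' : (0 : ℝ) < m := by exact_mod_cast hm
  have hpi : 0 < 2 * Real.pi := by positivity
  have h : ∀ v : ℝ, 0 ≤ v → v < 1 → ⌊(m : ℝ) * v⌋₊ < m := by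
    intro v h0 h1
    rw [Nat.floor_lt (by positivity)]
    nlinarith
  obtain ⟨⟨h1, h2⟩, h3, h4⟩ := hy
  refine ⟨h _ (div_nonneg h1 hpi.le) ((div_lt_one hpi).2 h2), h _ (radialCdf_nonneg hα hR _) ?_⟩
  have := radialCdf_strictMonoOn hα hR h3 hR.le h4
  rwa [radialCdf_self hα hR] at this

end

/-! ### Chernoff bound with base 2 -/

section Chernoff

variable {Ω : Type*}

theorem two_pow_ncard_eq_prod {n : ℕ} (S : Set Ω) (x : Fin n → Ω) :
    (2 : ENNReal) ^ {i | x i ∈ S}.ncard = ∏ i, (1 + S.indicator 1 (x i)) := by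
  classical
  have h : ∀ i, (1 + S.indicator 1 (x i) : ENNReal) = if x i ∈ S then 2 else 1 := by
    intro i
    by_cases hi : x i ∈ S <;> simp [hi, one_add_one_eq_two]
  simp_rw [h]
  rw [Finset.prod_ite, Finset.prod_const, Finset.prod_const_one, mul_one, Set.ncard_eq_toFinset_card']
  congr 2
  ext i
  simp

theorem measurable_two_pow_ncard [MeasurableSpace Ω] {n : ℕ} {S : Set Ω} (hS : MeasurableSet S) :
    Measurable fun x : Fin n → Ω => (2 : ENNReal) ^ {i | x i ∈ S}.ncard := by
  simp_rw [two_pow_ncard_eq_prod]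
  refine Finset.measurable_prod _ fun i _ => ?_
  have hmeas : Measurable fun y : Ω => (1 + S.indicator 1 y : ENNReal) :=
    (measurable_one.indicator hS).const_add 1
  exact hmeas.comp (measurable_pi_apply i)

/-- Rewrites the event on the count as a superlevel set of the exponential moment, both for
measurability and for Markov's inequality. -/
theorem le_ncard_iff {n t : ℕ} (S : Set Ω) (x : Fin n → Ω) :
    t ≤ {i | x i ∈ S}.ncard ↔ (2 : ENNReal) ^ t ≤ 2 ^ {i | x i ∈ S}.ncard := by
  constructor
  · intro h
    exact pow_le_pow_right₀ one_le_two h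
  · intro h
    have h' : ((2 ^ t : ℕ) : ENNReal) ≤ ((2 ^ {i | x i ∈ S}.ncard : ℕ) : ENNReal) := by
      push_cast
      exact h
    exact (Nat.pow_le_pow_iff_right (by norm_num)).1 (Nat.cast_le.1 h')

theorem measurableSet_le_ncard [MeasurableSpace Ω] {n : ℕ} {S : Set Ω} (hS : MeasurableSet S) (t : ℕ) :
    MeasurableSet {x : Fin n → Ω | t ≤ {i | x i ∈ S}.ncard} := by
  simp_rw [le_ncard_iff]
  exact measurableSet_le measurable_const (measurable_two_pow_ncard hS)

/-- A Chernoff bound for the number of independent random points in a set of small measure. -/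
theorem measure_le_ncard_le [MeasurableSpace Ω] {n : ℕ} (μ : Measure Ω) [IsProbabilityMeasure μ] {S : Set Ω}
    (hS : MeasurableSet S) {p : ℝ} (hp : 0 ≤ p) (hμ : μ S ≤ ENNReal.ofReal p) (t : ℕ) :
    Measure.pi (fun _ : Fin n => μ) {x | t ≤ {i | x i ∈ S}.ncard} ≤
      ENNReal.ofReal (Real.exp (n * p) / 2 ^ t) := by
  -- By independence the expectation is a product of factors `1 + μ S ≤ 1 + p ≤ exp p`.
  have hint : ∫⁻ x, (2 : ENNReal) ^ {i | x i ∈ S}.ncard ∂(Measure.pi (fun _ : Fin n => μ)) ≤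
      ENNReal.ofReal (Real.exp (n * p)) := by
    have hmeas : Measurable fun y : Ω => (1 + S.indicator 1 y : ENNReal) :=
      (measurable_one.indicator hS).const_add 1
    have h1 : ∫⁻ y, (1 + S.indicator 1 y : ENNReal) ∂μ ≤ ENNReal.ofReal (Real.exp p) := by
      rw [lintegral_add_left measurable_const, lintegral_indicator_one hS, lintegral_const,
        measure_univ, mul_one]
      calc (1 : ENNReal) + μ S ≤ 1 + ENNReal.ofReal p := by gcongr
        _ = ENNReal.ofReal (1 + p) := by
          rw [ENNReal.ofReal_add zero_le_one hp, ENNReal.ofReal_one]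
        _ ≤ _ := ENNReal.ofReal_le_ofReal (by linarith [Real.add_one_le_exp p])
    simp_rw [two_pow_ncard_eq_prod]
    rw [ProbabilityTheory.lintegral_prod_eq_prod_lintegral_of_indepFun Finset.univ
      (fun i (x : Fin n → Ω) => (1 + S.indicator 1 (x i) : ENNReal))
      (ProbabilityTheory.iIndepFun_pi fun _ => hmeas.aemeasurable)
      (fun i => hmeas.comp (measurable_pi_apply i))]
    have h2 : ∀ i : Fin n, ∫⁻ x : Fin n → Ω, (1 + S.indicator 1 (x i) : ENNReal)
        ∂(Measure.pi (fun _ : Fin n => μ)) = ∫⁻ y, (1 + S.indicator 1 y : ENNReal) ∂μ := by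
      intro i
      exact (measurePreserving_eval (fun _ : Fin n => μ) i).lintegral_comp hmeas
    simp_rw [h2]
    rw [Finset.prod_const, Finset.card_univ, Fintype.card_fin, Real.exp_nat_mul,
      ENNReal.ofReal_pow (Real.exp_pos p).le]
    gcongr
  have hmarkov := mul_meas_ge_le_lintegral (μ := Measure.pi (fun _ : Fin n => μ))
    (measurable_two_pow_ncard (n := n) hS) (2 ^ t)
  simp_rw [← le_ncard_iff] at hmarkov
  rw [ENNReal.ofReal_div_of_pos (by positivity), ENNReal.le_div_iff_mul_le (by simp) (by simp),
    mul_comm, ENNReal.ofReal_pow (by norm_num), ENNReal.ofReal_ofNat]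
  exact hmarkov.trans hint

end Chernoff

/-! ### Probability of grid cells and the union bound over paths -/

section PointLaw

variable {α R : ℝ}

theorem radialLaw_Icc (hα : 0 < α) (hR : 0 < R) {a b : ℝ} (ha : 0 ≤ a) (hab : a ≤ b)
    (hb : b ≤ R) :
    radialLaw α R (Set.Icc a b) = ENNReal.ofReal (radialCdf α R b - radialCdf α R a) := by
  have hcont : Continuous (radialDensity α R) := by
    unfold radialDensity
    exact (continuous_const.mul (Real.continuous_sinh.comp (continuous_const.mul continuous_id))).div_const _
  have hderiv : ∀ r ∈ Set.uIcc a b, HasDerivAt (radialCdf α R) (radialDensity α R r) r := by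
    intro r _
    have h1 : HasDerivAt (fun r => α * r) α r := by simpa using (hasDerivAt_id r).const_mul α
    have h2 := ((h1.cosh).sub_const 1).div_const (Real.cosh (α * R) - 1)
    unfold radialDensity
    rw [mul_comm α]
    exact h2
  have hint : ∫ r in Set.Icc a b, radialDensity α R r = radialCdf α R b - radialCdf α R a := by
    rw [integral_Icc_eq_integral_Ioc, ← intervalIntegral.integral_of_le hab]
    exact intervalIntegral.integral_eq_sub_of_hasDerivAt hderiv (hcont.intervalIntegrable _ _)
  have hsub : Set.Icc a b ⊆ Set.Icc 0 R := Set.Icc_subset_Icc ha hb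
  rw [radialLaw, withDensity_apply _ measurableSet_Icc, Measure.restrict_restrict measurableSet_Icc,
    Set.inter_eq_left.2 hsub, ← hint, ofReal_integral_eq_lintegral_ofReal]
  · exact hcont.continuousOn.integrableOn_Icc
  · filter_upwards [ae_restrict_mem measurableSet_Icc] with r hr
    exact div_nonneg (mul_nonneg hα.le (Real.sinh_nonneg_iff.2 (mul_nonneg hα.le (ha.trans hr.1))))
      (cosh_mul_sub_one_pos hα hR).le

theorem isProbabilityMeasure_radialLaw (hα : 0 < α) (hR : 0 < R) :
    IsProbabilityMeasure (radialLaw α R) := by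
  refine ⟨?_⟩
  have h := radialLaw_Icc hα hR le_rfl hR.le le_rfl
  rw [radialCdf_self hα hR, radialCdf_zero, sub_zero, ENNReal.ofReal_one] at h
  rw [← h, radialLaw, withDensity_apply _ MeasurableSet.univ,
    withDensity_apply _ measurableSet_Icc, Measure.restrict_restrict measurableSet_Icc,
    Set.inter_self, Measure.restrict_univ]

theorem isProbabilityMeasure_angularLaw : IsProbabilityMeasure angularLaw := by
  apply ProbabilityTheory.cond_isProbabilityMeasure_of_finite
  · simp [Real.pi_pos]
  · rw [Real.volume_Ico]
    exact ENNReal.ofReal_ne_top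

theorem isProbabilityMeasure_pointLaw (hα : 0 < α) (hR : 0 < R) :
    IsProbabilityMeasure (pointLaw α R) := by
  have := isProbabilityMeasure_radialLaw hα hR
  have := isProbabilityMeasure_angularLaw
  unfold pointLaw
  infer_instance

theorem angularLaw_Icc_le (a b : ℝ) :
    angularLaw (Set.Icc a b) ≤ ENNReal.ofReal ((b - a) / (2 * Real.pi)) := by
  rw [angularLaw, ProbabilityTheory.cond_apply measurableSet_Ico, Real.volume_Ico, sub_zero,
    ENNReal.ofReal_div_of_pos (by positivity), div_eq_mul_inv, mul_comm]
  gcongr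
  exact (measure_mono Set.inter_subset_right).trans Real.volume_Icc.le

theorem exists_radialCdf_eq (hα : 0 < α) (hR : 0 < R) {t : ℝ} (h0 : 0 ≤ t) (h1 : t ≤ 1) :
    ∃ r ∈ Set.Icc 0 R, radialCdf α R r = t := by
  have hc : ContinuousOn (radialCdf α R) (Set.Icc 0 R) := by
    apply Continuous.continuousOn
    unfold radialCdf
    exact ((Real.continuous_cosh.comp (continuous_const.mul continuous_id)).sub
      continuous_const).div_const _
  have := intermediate_value_Icc hR.le hc
  rw [radialCdf_zero, radialCdf_self hα hR] at this
  exact this ⟨h0, h1⟩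

theorem pointLaw_gridCell_le (hα : 0 < α) (hR : 0 < R) {m : ℕ} (hm : 0 < m) (p : ℕ × ℕ) :
    pointLaw α R {y | y ∈ rootRegion R ∧ gridIndex α R m y = p} ≤
      ENNReal.ofReal (1 / (m : ℝ) ^ 2) := by
  have := isProbabilityMeasure_radialLaw hα hR
  have hm' : (0 : ℝ) < m := by exact_mod_cast hm
  have hpi : 0 < 2 * Real.pi := by positivity
  -- A nonempty fibre has `p.2 < m`, so both `p.2 / m` and `(p.2 + 1) / m` are values of the radial
  -- distribution function on `[0, R]`.
  rcases Set.eq_empty_or_nonempty {y | y ∈ rootRegion R ∧ gridIndex α R m y = p} with he | hne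
  · rw [he, measure_empty]
    exact zero_le
  · obtain ⟨y₀, hy₀, hp₀⟩ := hne
    have hlt : p.2 < m := hp₀ ▸ (gridIndex_lt hα hR hm hy₀).2
    have hlt' : (p.2 : ℝ) + 1 ≤ m := by exact_mod_cast hlt
    obtain ⟨r, hr, hr'⟩ := exists_radialCdf_eq hα hR (t := p.2 / m) (by positivity)
      (by rw [div_le_one hm']; linarith)
    obtain ⟨s, hs, hs'⟩ := exists_radialCdf_eq hα hR (t := (p.2 + 1) / m) (by positivity)
      (by rwa [div_le_one hm'])
    have hmono := radialCdf_strictMonoOn hα hR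
    have hrs : r ≤ s := by
      rw [← hmono.le_iff_le hr.1 hs.1, hr', hs']
      gcongr
      linarith
    have hsub : {y | y ∈ rootRegion R ∧ gridIndex α R m y = p} ⊆
        Set.Icc (2 * Real.pi * (p.1 / m)) (2 * Real.pi * ((p.1 + 1) / m)) ×ˢ Set.Icc r s := by
      rintro y ⟨⟨hy1, hy2⟩, hp⟩
      have hp1 : ⌊(m : ℝ) * (y.1 / (2 * Real.pi))⌋₊ = p.1 := congrArg Prod.fst hp
      have hp2 : ⌊(m : ℝ) * radialCdf α R y.2⌋₊ = p.2 := congrArg Prod.snd hp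
      rw [Nat.floor_eq_iff (mul_nonneg hm'.le (div_nonneg hy1.1 hpi.le))] at hp1
      rw [Nat.floor_eq_iff (mul_nonneg hm'.le (radialCdf_nonneg hα hR _))] at hp2
      refine ⟨⟨?_, ?_⟩, ?_, ?_⟩
      · rw [← le_div_iff₀' hpi, div_le_iff₀' hm']
        exact hp1.1
      · rw [← div_le_iff₀' hpi, le_div_iff₀' hm']
        exact hp1.2.le
      · rw [← hmono.le_iff_le hr.1 hy2.1, hr', div_le_iff₀' hm']
        exact hp2.1
      · rw [← hmono.le_iff_le hy2.1 hs.1, hs', le_div_iff₀' hm']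
        exact hp2.2.le
    refine (measure_mono hsub).trans ?_
    rw [pointLaw, Measure.prod_prod, radialLaw_Icc hα hR hr.1 hrs hs.2, hr', hs']
    refine (mul_le_mul_left (angularLaw_Icc_le _ _) _).trans ?_
    rw [← ENNReal.ofReal_mul (div_nonneg ?_ hpi.le)]
    · apply le_of_eq
      congr 1
      field_simp
      ring
    · rw [sub_nonneg]
      gcongr
      linarith

theorem measurable_gridIndex (m : ℕ) : Measurable (gridIndex α R m) := by
  unfold gridIndex radialCdf
  refine Measurable.prodMk ?_ ?_
  · exact Nat.measurable_floor.comp (by fun_prop)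
  · refine Nat.measurable_floor.comp ?_
    have : Measurable fun y : PolarPoint => Real.cosh (α * y.2) :=
      Real.measurable_cosh.comp (by fun_prop)
    fun_prop

/-- The points whose grid cell belongs to a given set of grid cells. -/
def gridSet (α R : ℝ) (m : ℕ) (T : Finset (ℕ × ℕ)) : Set PolarPoint :=
  {y | y ∈ rootRegion R ∧ gridIndex α R m y ∈ T}

theorem measurableSet_gridSet (m : ℕ) (T : Finset (ℕ × ℕ)) :
    MeasurableSet (gridSet α R m T) :=
  (measurableSet_Ico.prod measurableSet_Ico).inter
    (measurable_gridIndex m (Finset.measurableSet T))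

theorem pointLaw_gridSet_le (hα : 0 < α) (hR : 0 < R) {m : ℕ} (hm : 0 < m)
    {T : Finset (ℕ × ℕ)} (hT : T.card ≤ 2 * m) :
    pointLaw α R (gridSet α R m T) ≤ ENNReal.ofReal (2 / m) := by
  have hm' : (0 : ℝ) < m := by exact_mod_cast hm
  have hU : gridSet α R m T = ⋃ p ∈ T, {y | y ∈ rootRegion R ∧ gridIndex α R m y = p} := by
    ext y
    simp [gridSet]
  rw [hU]
  calc _ ≤ ∑ p ∈ T, pointLaw α R {y | y ∈ rootRegion R ∧ gridIndex α R m y = p} :=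
        measure_biUnion_finset_le _ _
    _ ≤ ∑ _p ∈ T, ENNReal.ofReal (1 / (m : ℝ) ^ 2) :=
        Finset.sum_le_sum fun p _ => pointLaw_gridCell_le hα hR hm p
    _ = ENNReal.ofReal (T.card * (1 / (m : ℝ) ^ 2)) := by
        rw [Finset.sum_const, ← ENNReal.ofReal_nsmul, nsmul_eq_mul]
    _ ≤ ENNReal.ofReal (2 / m) := by
        apply ENNReal.ofReal_le_ofReal
        have : (T.card : ℝ) ≤ 2 * m := by exact_mod_cast hT
        calc (T.card : ℝ) * (1 / (m : ℝ) ^ 2) ≤ (2 * m : ℝ) * (1 / (m : ℝ) ^ 2) := by gcongr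
          _ = 2 / (m : ℝ) := by field_simp

/-- The event that every path of grid cells contains fewer than `t` of the points. -/
def sparsePaths (α R : ℝ) (n m t : ℕ) : Set (Fin n → PolarPoint) :=
  {x | ∀ T ∈ pathFamily m, {i | x i ∈ gridSet α R m T}.ncard < t}

theorem compl_sparsePaths (n m t : ℕ) :
    (sparsePaths α R n m t)ᶜ =
      ⋃ T ∈ pathFamily m, {x | t ≤ {i | x i ∈ gridSet α R m T}.ncard} := by
  ext x
  simp [sparsePaths]

theorem measurableSet_sparsePaths (n m t : ℕ) : MeasurableSet (sparsePaths α R n m t) := by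
  rw [← MeasurableSet.compl_iff, compl_sparsePaths]
  exact Finset.measurableSet_biUnion _ fun T _ =>
    measurableSet_le_ncard (measurableSet_gridSet m T) t

/-- A path holds at most `n * (2 / m) ≤ 8 * m` points on average, and `exp 8 ≤ 2 ^ 12`, so it
reaches `20 * m` points with probability at most `2 ^ (-8 * m)`. This outweighs the `2 * 4 ^ m`
paths and the factor `n`. -/
theorem measure_sparsePaths_ge (hα : 0 < α) (hR : 0 < R) {n m : ℕ} (hm : 0 < m) (hn : 0 < n)
    (hnm : n < 4 * m ^ 2) :
    1 - (n : ENNReal)⁻¹ ≤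
      Measure.pi (fun _ : Fin n => pointLaw α R) (sparsePaths α R n m (20 * m)) := by
  have := isProbabilityMeasure_pointLaw hα hR
  have hm' : (0 : ℝ) < m := by exact_mod_cast hm
  set P := Measure.pi (fun _ : Fin n => pointLaw α R)
  have hbad : P (sparsePaths α R n m (20 * m))ᶜ ≤ (n : ENNReal)⁻¹ := by
    rw [compl_sparsePaths]
    have hexp : Real.exp (n * (2 / m)) ≤ 2 ^ (12 * m) := by
      have h1 : (n : ℝ) * (2 / m) ≤ m * 8 := by
        have : (n : ℝ) ≤ 4 * m ^ 2 := by exact_mod_cast hnm.le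
        rw [mul_div_assoc', div_le_iff₀ hm']
        nlinarith
      calc Real.exp (n * (2 / m)) ≤ Real.exp (m * 8) := Real.exp_le_exp.2 h1
        _ = (Real.exp 1 ^ 8) ^ m := by
          have h8 : Real.exp 8 = Real.exp 1 ^ 8 := by
            rw [← Real.exp_nat_mul]
            norm_num
          rw [Real.exp_nat_mul, h8]
        _ ≤ (2 ^ 12) ^ m := by
          gcongr
          calc Real.exp 1 ^ 8 ≤ 2.7182818286 ^ 8 := by
                gcongr
                exact Real.exp_one_lt_d9.le
            _ ≤ 2 ^ 12 := by norm_num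
        _ = 2 ^ (12 * m) := (pow_mul _ _ _).symm
    have hn' : (0 : ℝ) < n := by exact_mod_cast hn
    have hcount : (2 * 4 ^ m : ℝ) * (Real.exp (n * (2 / m)) / 2 ^ (20 * m)) ≤ (n : ℝ)⁻¹ := by
      have h1 : (m : ℝ) ≤ 2 ^ m := by exact_mod_cast Nat.lt_two_pow_self.le
      have h2 : (n : ℝ) ≤ 4 * m ^ 2 := by exact_mod_cast hnm.le
      have h3 : (2 : ℝ) ≤ 2 ^ m := by
        calc (2 : ℝ) = 2 ^ 1 := by norm_num
          _ ≤ 2 ^ m := pow_le_pow_right₀ (by norm_num) hm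
      have h4 : (4 : ℝ) ^ m = (2 ^ m) ^ 2 := by rw [← pow_mul, mul_comm, pow_mul]; norm_num
      rw [← one_div, le_div_iff₀ hn', mul_div_assoc', div_mul_eq_mul_div, div_le_one (by positivity)]
      rw [mul_comm 12 m, pow_mul] at hexp
      rw [h4, mul_comm 20 m, pow_mul]
      -- Everything is compared with powers of `z ≥ 2`: the number of paths is at most `2 * z ^ 2`,
      -- the exponential at most `z ^ 12`, and `n ≤ 4 * z ^ 2` because `m ≤ z`.
      set z : ℝ := 2 ^ m
      calc 2 * z ^ 2 * Real.exp (n * (2 / m)) * n ≤ 2 * z ^ 2 * z ^ 12 * (4 * z ^ 2) := by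
            gcongr
            calc (n : ℝ) ≤ 4 * m ^ 2 := h2
              _ ≤ 4 * z ^ 2 := by gcongr
        _ = 2 ^ 3 * z ^ 16 := by ring
        _ ≤ z ^ 4 * z ^ 16 := by
            gcongr
            calc (2 : ℝ) ^ 3 ≤ 2 ^ 4 := by norm_num
              _ ≤ z ^ 4 := by gcongr
        _ = z ^ 20 := by ring
    calc P (⋃ T ∈ pathFamily m, {x | 20 * m ≤ {i | x i ∈ gridSet α R m T}.ncard})
        ≤ ∑ T ∈ pathFamily m, P {x | 20 * m ≤ {i | x i ∈ gridSet α R m T}.ncard} :=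
          measure_biUnion_finset_le _ _
      _ ≤ ∑ _T ∈ pathFamily m, ENNReal.ofReal (Real.exp (n * (2 / m)) / 2 ^ (20 * m)) :=
          Finset.sum_le_sum fun T hT => measure_le_ncard_le (pointLaw α R)
            (measurableSet_gridSet m T) (by positivity)
            (pointLaw_gridSet_le hα hR hm (card_le_of_mem_pathFamily hT)) _
      _ = ENNReal.ofReal ((pathFamily m).card * (Real.exp (n * (2 / m)) / 2 ^ (20 * m))) := by
          rw [Finset.sum_const, ← ENNReal.ofReal_nsmul, nsmul_eq_mul]
      _ ≤ ENNReal.ofReal (n : ℝ)⁻¹ := by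
          apply ENNReal.ofReal_le_ofReal
          refine le_trans ?_ hcount
          have : ((pathFamily m).card : ℝ) ≤ 2 * 4 ^ m := by exact_mod_cast card_pathFamily_le m
          gcongr
      _ = (n : ENNReal)⁻¹ := by rw [ENNReal.ofReal_inv_of_pos hn', ENNReal.ofReal_natCast]
  rw [← compl_compl (sparsePaths α R n m (20 * m)),
    prob_compl_eq_one_sub (measurableSet_sparsePaths n m _).compl]
  exact tsub_le_tsub_left hbad 1

end PointLaw

/-! ### Charging, and grid cells met by a circle -/

theorem exists_ncard_bound_of_injOn {ι κ : Type*} {s : Set ι} {t : Set κ} (ht : t.Finite)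
    (r : ι → κ → Prop) (hex : ∀ a ∈ s, ∃ b ∈ t, r a b)
    (hinj : ∀ a ∈ s, ∀ a' ∈ s, ∀ b, r a b → r a' b → a = a') :
    s.Finite ∧ s.ncard ≤ t.ncard := by
  rcases s.eq_empty_or_nonempty with rfl | ⟨a₀, ha₀⟩
  · simp
  have : Nonempty κ := ⟨(hex a₀ ha₀).choose⟩
  choose! f hft hfr using hex
  have hf : Set.InjOn f s := fun a ha a' ha' h =>
    hinj a ha a' ha' (f a) (hfr a ha) (h ▸ hfr a' ha')
  exact ⟨Set.Finite.of_injOn hft hf ht, Set.ncard_le_ncard_of_injOn f hft hf ht⟩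

section Grid

variable {α R : ℝ}

theorem gridIndex_mono (hα : 0 < α) (hR : 0 < R) (m : ℕ) {y z : PolarPoint} :
    (y.1 ≤ z.1 → (gridIndex α R m y).1 ≤ (gridIndex α R m z).1) ∧
    (0 ≤ y.2 → y.2 ≤ z.2 → (gridIndex α R m y).2 ≤ (gridIndex α R m z).2) := by
  constructor
  · intro h
    have : 0 < 2 * Real.pi := by positivity
    exact Nat.floor_mono (by gcongr)
  · intro h0 h
    have := (radialCdf_strictMonoOn hα hR).monotoneOn h0 (h0.trans h) h
    exact Nat.floor_mono (by gcongr)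

/-- Both grid coordinates are monotone in the polar ones, so the chain property passes to the grid;
points of equal radius lie in the same grid row and do no harm. -/
theorem exists_pathFamily_cover (hα : 0 < α) (hR : 0 < R) {m : ℕ} (hm : 0 < m)
    {Q : Set PolarPoint} (hQR : Q ⊆ rootRegion R) (hQ : IsMonotoneSet Q ∨ IsAntitoneSet Q) :
    ∃ T ∈ pathFamily m, gridIndex α R m '' Q ⊆ T := by
  apply exists_mem_pathFamily
  · rintro _ ⟨y, hy, rfl⟩
    exact gridIndex_lt hα hR hm (hQR hy)
  · rcases hQ with hQ | hQ
    · left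
      rintro _ ⟨y, hy, rfl⟩ _ ⟨z, hz, rfl⟩ hlt
      have h1 := (gridIndex_mono hα hR m (y := z) (z := y)).1
      have h2 := (gridIndex_mono hα hR m (y := y) (z := z)).2 (hQR hy).2.1
      rcases le_or_gt y.2 z.2 with h | h
      · exact h2 h
      · rcases hQ z hz y hy h.le with h' | h'
        · exact absurd (h1 h') (not_le.2 hlt)
        · exact h2 h'.ge
    · right
      rintro _ ⟨y, hy, rfl⟩ _ ⟨z, hz, rfl⟩ hlt
      have h1 := (gridIndex_mono hα hR m (y := z) (z := y)).1
      have h2 := (gridIndex_mono hα hR m (y := z) (z := y)).2 (hQR hz).2.1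
      rcases le_or_gt z.2 y.2 with h | h
      · exact h2 h
      · rcases hQ y hy z hz h.le with h' | h'
        · exact absurd (h1 h') (not_le.2 hlt)
        · exact h2 h'.ge

/-- On a sparse sample, every circle meets few grid cells, and these contain few points. -/
theorem circle_grid_bounds (hα : 0 < α) (hR : 0 < R) {n m t : ℕ} (hm : 0 < m)
    {x : Fin n → PolarPoint} (hx : x ∈ sparsePaths α R n m t) (c : ℂ) (ρ : ℝ) :
    (gridIndex α R m '' circlePoints R c ρ).Finite ∧
    (gridIndex α R m '' circlePoints R c ρ).ncard ≤ 18 * m ∧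
    {i | x i ∈ rootRegion R ∧
      gridIndex α R m (x i) ∈ gridIndex α R m '' circlePoints R c ρ}.ncard ≤ 9 * t := by
  obtain ⟨Q, hQ, hU⟩ := exists_monotone_pieces R c ρ
  have hQR : ∀ k, Q k ⊆ rootRegion R := fun k y hy =>
    ((hU ▸ Set.mem_iUnion.2 ⟨k, hy⟩ : y ∈ circlePoints R c ρ)).1
  choose T hT hQT using fun k => exists_pathFamily_cover hα hR hm (hQR k) (hQ k)
  have hcard : Fintype.card (Option (Fin 4 × Bool)) = 9 := by simp
  have hsub : gridIndex α R m '' circlePoints R c ρ ⊆ (Finset.univ.biUnion T : Finset (ℕ × ℕ)) := by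
    rw [hU, Set.image_iUnion]
    intro p hp
    obtain ⟨k, hk⟩ := Set.mem_iUnion.1 hp
    rw [Finset.mem_coe, Finset.mem_biUnion]
    exact ⟨k, Finset.mem_univ k, hQT k hk⟩
  refine ⟨(Finset.finite_toSet _).subset hsub, ?_, ?_⟩
  · calc _ ≤ (Finset.univ.biUnion T).card := by
          rw [← Set.ncard_coe_finset]
          exact Set.ncard_le_ncard hsub (Finset.finite_toSet _)
      _ ≤ Finset.univ.card * (2 * m) :=
          Finset.card_biUnion_le_card_mul _ _ _ fun k _ => card_le_of_mem_pathFamily (hT k)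
      _ = 18 * m := by rw [Finset.card_univ, hcard]; ring
  · classical
    have hsub' : {i | x i ∈ rootRegion R ∧
        gridIndex α R m (x i) ∈ gridIndex α R m '' circlePoints R c ρ} ⊆
        (Finset.univ.biUnion fun k => {i | x i ∈ gridSet α R m (T k)}.toFinset : Finset (Fin n)) := by
      rintro i ⟨hi, hi'⟩
      have := hsub hi'
      rw [Finset.mem_coe, Finset.mem_biUnion] at this ⊢
      obtain ⟨k, hk, hik⟩ := this
      exact ⟨k, hk, by rw [Set.mem_toFinset]; exact ⟨hi, hik⟩⟩
    calc _ ≤ (Finset.univ.biUnion fun k =>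
            {i | x i ∈ gridSet α R m (T k)}.toFinset : Finset (Fin n)).card := by
          rw [← Set.ncard_coe_finset]
          exact Set.ncard_le_ncard hsub' (Finset.finite_toSet _)
      _ ≤ Finset.univ.card * t :=
          Finset.card_biUnion_le_card_mul _ _ _ fun k _ => by
            rw [← Set.ncard_eq_toFinset_card']
            exact (hx (T k) (hT k)).le
      _ = 9 * t := by rw [Finset.card_univ, hcard]

end Grid

/-! ### Charging the examined cells -/

section Query

variable {α R : ℝ} {κ n : ℕ} {x : Fin n → PolarPoint}

/-- The parents of the bottom leaf cells that a range query examines. -/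
def examinedParents (α R : ℝ) (κ : ℕ) (x : Fin n → PolarPoint) (c : ℂ) (ρ : ℝ) : Set Address :=
  {p | ∃ q, q :: p ∈ examinedBottomLeaves α R κ x c ρ}

theorem lt_load_of_mem_examinedParents {c : ℂ} {ρ : ℝ} {p : Address}
    (hp : p ∈ examinedParents α R κ x c ρ) : κ < load α R x p := by
  obtain ⟨q, ⟨⟨hnode, -⟩, -⟩, -⟩ := hp
  cases hnode with
  | child _ _ _ h => exact h

/-- This is where the bottom condition enters: the siblings of a bottom leaf are leaves too. -/
theorem load_child_le_of_mem_examinedParents {c : ℂ} {ρ : ℝ} {p : Address}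
    (hp : p ∈ examinedParents α R κ x c ρ) (q : Bool × Bool) : load α R x (q :: p) ≤ κ := by
  obtain ⟨q', ⟨⟨hnode, hload⟩, hsib⟩, -⟩ := hp
  by_cases h : q' = q
  · rwa [h] at hload
  · cases hnode with
    | child _ _ hn h' => exact (hsib (q :: p) ⟨p, q', q, h, rfl, rfl⟩ (.child p q hn h')).2

theorem load_mono {a b : Address} (h : (cellAt α R a).region ⊆ (cellAt α R b).region) :
    load α R x a ≤ load α R x b :=
  Set.ncard_le_ncard (fun _ hi => h hi) (Set.toFinite _)

/-- Cells that share a point are nested. A parent strictly below another would lie in one of its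
children, which holds at most `κ` points, whereas a split cell holds more. -/
theorem eq_of_mem_examinedParents (hα : 0 < α) (hR : 0 < R) {c : ℂ} {ρ : ℝ} {p p' : Address}
    (hp : p ∈ examinedParents α R κ x c ρ) (hp' : p' ∈ examinedParents α R κ x c ρ)
    {y : PolarPoint} (hy : y ∈ (cellAt α R p).region) (hy' : y ∈ (cellAt α R p').region) :
    p = p' := by
  wlog hle : p.length ≤ p'.length generalizing p p'
  · exact (this hp' hp hy' hy (not_le.1 hle).le).symm
  obtain ⟨l, rfl⟩ := suffix_of_mem_region hα hR hle hy hy'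
  rcases List.eq_nil_or_concat l with rfl | ⟨l', q, rfl⟩
  · rfl
  · have h1 := lt_load_of_mem_examinedParents hp'
    have h2 := load_child_le_of_mem_examinedParents hp q
    rw [List.concat_eq_append, List.append_assoc] at h1
    have h3 := load_mono (x := x) (region_append_subset hα hR l' (q :: p))
    exact absurd (h1.trans_le (h3.trans h2)) (lt_irrefl _)

theorem exists_mem_of_mem_examinedParents {c : ℂ} {ρ : ℝ} {p : Address}
    (hp : p ∈ examinedParents α R κ x c ρ) : ∃ i, x i ∈ (cellAt α R p).region := by
  have h : 0 < load α R x p := (Nat.zero_le κ).trans_lt (lt_load_of_mem_examinedParents hp)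
  exact Set.nonempty_of_ncard_ne_zero h.ne'

/-- The cell of an examined parent lies inside the query circle or meets it. -/
theorem inside_or_crossing (hα : 0 < α) (hR : 0 < R) {c : ℂ} {ρ : ℝ} {p : Address}
    (hp : p ∈ examinedParents α R κ x c ρ) :
    (∀ y ∈ (cellAt α R p).region, toPoincare y ∈ Metric.ball c ρ) ∨
      ∃ y ∈ (cellAt α R p).region, y ∈ circlePoints R c ρ := by
  by_cases hin : ∀ y ∈ (cellAt α R p).region, toPoincare y ∈ Metric.ball c ρ
  · exact Or.inl hin
  right
  push Not at hin
  obtain ⟨z, hz, hz'⟩ := hin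
  obtain ⟨q, -, hex⟩ := hp
  cases hex with
  | child _ _ _ _ hne =>
    obtain ⟨_, ⟨y, hy, rfl⟩, hyc⟩ := hne
    -- The cell is convex in polar coordinates and has a point in the closed disk and one outside
    -- the open disk, so the distance to `c` takes the value `ρ` on it.
    have hconn : IsPreconnected (cellAt α R p).region :=
      ((convex_Ico _ _).prod (convex_Ico _ _)).isPreconnected
    have hcont : ContinuousOn (fun y => ‖toPoincare y - c‖) (cellAt α R p).region :=
      (continuous_toPoincare.sub continuous_const).norm.continuousOn
    have h1 : ‖toPoincare y - c‖ ≤ ρ := by rwa [← dist_eq_norm]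
    have h2 : ρ ≤ ‖toPoincare z - c‖ := by
      rw [← dist_eq_norm]
      exact not_lt.1 hz'
    obtain ⟨w, hw, hw'⟩ := hconn.intermediate_value (region_child_subset hα hR q p hy) hz hcont
      ⟨h1, h2⟩
    exact ⟨w, hw, region_subset_rootRegion hα hR p hw, hw'⟩

/-- `P₁` is charged to returned points, `P₂` to sample points in grid cells met by the circle, `P₃`
to those grid cells. Disjointness of the parents makes each charge injective. -/
theorem examinedParents_bound (hα : 0 < α) (hR : 0 < R) {j t : ℕ}
    (hx : x ∈ sparsePaths α R n (2 ^ j) t) (c : ℂ) (ρ : ℝ) :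
    (examinedParents α R κ x c ρ).Finite ∧
    (examinedParents α R κ x c ρ).ncard ≤ (queryResult x c ρ).ncard + 9 * t + 18 * 2 ^ j := by
  obtain ⟨hDfin, hD, hN⟩ := circle_grid_bounds hα hR (by positivity) hx c ρ
  set D := gridIndex α R (2 ^ j) '' circlePoints R c ρ
  set P := examinedParents α R κ x c ρ
  set P₁ := {p ∈ P | ∀ y ∈ (cellAt α R p).region, toPoincare y ∈ Metric.ball c ρ}
  set P₂ := {p ∈ P | j ≤ p.length ∧ ∃ y ∈ (cellAt α R p).region, y ∈ circlePoints R c ρ}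
  set P₃ := {p ∈ P | p.length ≤ j ∧ ∃ y ∈ (cellAt α R p).region, y ∈ circlePoints R c ρ}
  have hP : P ⊆ P₁ ∪ P₂ ∪ P₃ := by
    intro p hp
    rcases inside_or_crossing hα hR hp with h | h
    · exact Or.inl (Or.inl ⟨hp, h⟩)
    · rcases le_total j p.length with hj | hj
      · exact Or.inl (Or.inr ⟨hp, hj, h⟩)
      · exact Or.inr ⟨hp, hj, h⟩
  have h₁ : P₁.Finite ∧ P₁.ncard ≤ (queryResult x c ρ).ncard := by
    refine exists_ncard_bound_of_injOn (Set.toFinite _)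
      (fun p i => x i ∈ (cellAt α R p).region) ?_ ?_
    · rintro p ⟨hp, hin⟩
      obtain ⟨i, hi⟩ := exists_mem_of_mem_examinedParents hp
      exact ⟨i, hin _ hi, hi⟩
    · exact fun p hp p' hp' i h h' => eq_of_mem_examinedParents hα hR hp.1 hp'.1 h h'
  have h₂ : P₂.Finite ∧ P₂.ncard ≤
      {i | x i ∈ rootRegion R ∧ gridIndex α R (2 ^ j) (x i) ∈ D}.ncard := by
    refine exists_ncard_bound_of_injOn (Set.toFinite _)
      (fun p i => x i ∈ (cellAt α R p).region) ?_ ?_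
    · rintro p ⟨hp, hj, y, hy, hyc⟩
      obtain ⟨i, hi⟩ := exists_mem_of_mem_examinedParents hp
      exact ⟨i, ⟨region_subset_rootRegion hα hR p hi, y, hyc,
        gridIndex_eq_of_mem_region hα hR hj hy hi⟩, hi⟩
    · exact fun p hp p' hp' i h h' => eq_of_mem_examinedParents hα hR hp.1 hp'.1 h h'
  have h₃ : P₃.Finite ∧ P₃.ncard ≤ D.ncard := by
    refine exists_ncard_bound_of_injOn hDfin
      (fun p d => ∃ y ∈ (cellAt α R p).region, gridIndex α R (2 ^ j) y = d) ?_ ?_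
    · rintro p ⟨hp, hj, y, hy, hyc⟩
      exact ⟨_, ⟨y, hyc, rfl⟩, y, hy, rfl⟩
    · rintro p hp p' hp' d ⟨y, hy, hyd⟩ ⟨y', hy', hyd'⟩
      exact eq_of_mem_examinedParents hα hR hp.1 hp'.1 (mem_region_of_gridIndex_eq hα hR
        hp.2.1 hy (region_subset_rootRegion hα hR p' hy') (hyd.trans hyd'.symm)) hy'
  have hfin : (P₁ ∪ P₂ ∪ P₃).Finite := (h₁.1.union h₂.1).union h₃.1
  refine ⟨hfin.subset hP, ?_⟩
  have e1 := Set.ncard_le_ncard hP hfin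
  have e2 := Set.ncard_union_le (P₁ ∪ P₂) P₃
  have e3 := Set.ncard_union_le P₁ P₂
  have e4 := h₁.2
  have e5 := h₂.2
  have e6 := h₃.2
  omega

theorem examinedBottomLeaves_bound {c : ℂ} {ρ : ℝ}
    (hfin : (examinedParents α R κ x c ρ).Finite) :
    (examinedBottomLeaves α R κ x c ρ).Finite ∧
    (examinedBottomLeaves α R κ x c ρ).ncard ≤
      1 + 4 * (examinedParents α R κ x c ρ).ncard := by
  set P := examinedParents α R κ x c ρ
  have hsub : examinedBottomLeaves α R κ x c ρ ⊆
      {[]} ∪ (fun z : (Bool × Bool) × Address => z.1 :: z.2) '' (Set.univ ×ˢ P) := by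
    -- The root has no parent, yet it is a bottom leaf when it is not split; it accounts for the
    -- summand 1.
    rintro (_ | ⟨q, p⟩) ha
    · exact Or.inl rfl
    · exact Or.inr ⟨(q, p), ⟨Set.mem_univ _, q, ha⟩, rfl⟩
  have hprod : ((Set.univ : Set (Bool × Bool)) ×ˢ P).Finite := Set.finite_univ.prod hfin
  have hfin' : ({[]} ∪ (fun z : (Bool × Bool) × Address => z.1 :: z.2) ''
      (Set.univ ×ˢ P)).Finite := (Set.finite_singleton _).union (hprod.image _)
  refine ⟨hfin'.subset hsub, ?_⟩
  have e1 := Set.ncard_le_ncard hsub hfin'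
  have e2 := Set.ncard_union_le {[]} ((fun z : (Bool × Bool) × Address => z.1 :: z.2) ''
      (Set.univ ×ˢ P))
  have e3 := Set.ncard_image_le (f := fun z : (Bool × Bool) × Address => z.1 :: z.2) hprod
  rw [Set.ncard_singleton] at e2
  rw [Set.ncard_prod, Set.ncard_univ, Nat.card_eq_fintype_card] at e3
  simp only [Fintype.card_prod, Fintype.card_bool] at e3
  omega

end Query

end PolarQuadtree

theorem lemma3 :
    ∃ (K : ℝ) (N : ℕ), ∀ n : ℕ, N ≤ n → ∀ (α R : ℝ) (κ : ℕ), 0 < α → 0 < R → 1 ≤ κ →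
      ∃ E : Set (Fin n → PolarQuadtree.PolarPoint), MeasurableSet E ∧
        1 - (n : ENNReal)⁻¹ ≤
          MeasureTheory.Measure.pi (fun _ : Fin n => PolarQuadtree.pointLaw α R) E ∧
        ∀ x ∈ E, ∀ (c : ℂ) (ρ : ℝ),
          (PolarQuadtree.examinedBottomLeaves α R κ x c ρ).Finite ∧
          ((PolarQuadtree.examinedBottomLeaves α R κ x c ρ).ncard : ℝ) ≤
            K * (Real.sqrt n + ((PolarQuadtree.queryResult x c ρ).ncard : ℝ)) := by
  -- With `m = 2 ^ j` and `t = 20 * m`, the count is at most `1 + 4 * (|A| + 180 * m + 18 * m) ≤ 793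
  -- * m + 4 * |A|`.
  refine ⟨793, 1, fun n hn α R κ hα hR _ => ?_⟩
  -- The logarithm to base 4 gives `m ^ 2 ≤ n < 4 * m ^ 2` for `m = 2 ^ j`.
  set j := Nat.log 4 n with hj
  have hpow : (4 : ℕ) ^ j = (2 ^ j) ^ 2 := by
    rw [← pow_mul, mul_comm, pow_mul]
    norm_num
  have hlo : (2 ^ j) ^ 2 ≤ n := hpow ▸ Nat.pow_log_le_self 4 (by omega)
  have hhi : n < 4 * (2 ^ j) ^ 2 := by
    have := Nat.lt_pow_succ_log_self (b := 4) (by norm_num) n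
    rw [← hj, pow_succ, hpow] at this
    omega
  refine ⟨PolarQuadtree.sparsePaths α R n (2 ^ j) (20 * 2 ^ j),
    PolarQuadtree.measurableSet_sparsePaths n _ _,
    PolarQuadtree.measure_sparsePaths_ge hα hR (by positivity) hn hhi, fun x hx c ρ => ?_⟩
  obtain ⟨hfin, hP⟩ := PolarQuadtree.examinedParents_bound (κ := κ) hα hR hx c ρ
  obtain ⟨hfin', hL⟩ := PolarQuadtree.examinedBottomLeaves_bound hfin
  refine ⟨hfin', ?_⟩
  have hm1 : 1 ≤ 2 ^ j := Nat.one_le_two_pow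
  have hle : (PolarQuadtree.examinedBottomLeaves α R κ x c ρ).ncard ≤
      793 * 2 ^ j + 4 * (PolarQuadtree.queryResult x c ρ).ncard := by omega
  have hsqrt : ((2 ^ j : ℕ) : ℝ) ≤ Real.sqrt n := Real.le_sqrt_of_sq_le (by exact_mod_cast hlo)
  have hle' : ((PolarQuadtree.examinedBottomLeaves α R κ x c ρ).ncard : ℝ) ≤
      793 * ((2 ^ j : ℕ) : ℝ) + 4 * ((PolarQuadtree.queryResult x c ρ).ncard : ℝ) := by
    exact_mod_cast hle
  have h0 : (0 : ℝ) ≤ ((PolarQuadtree.queryResult x c ρ).ncard : ℝ) := Nat.cast_nonneg _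
  linarith
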